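/- Let $n,d\ge 1$ be integers, let $A=(a_{ij})$ be the $n\times n$ matrix of variables, and write $\mathbb{C}[A]=\mathbb{C}[a_{ij}]$ and $N=\binom{n-1+d}{d}$. Fix an ordering of the $N$ monomials $x^\alpha$ of degree $d$ in $x=(x_1,\dots,x_n)$. Let $\rho_d(A)\in\mathbb{C}[A]^{N\times N}$ be the $d$-th symmetric power of $A$, that is, the matrix whose row indexed by $\alpha$ consists of the coefficients of $(Ax)^\alpha=\prod_i\big(\sum_j a_{ij}x_j\big)^{\alpha_i}$. For $f\in\mathbb{C}[x]_d$ (a homogeneous polynomial of degree $d$) with row vector of coefficients $C_f$, let $K_d(f)\in\mathbb{C}[A]^{N\times N}$ be the matrix with rows $C_f,\ C_f\rho_d(A),\ \dots,\ C_f\rho_d(A)^{N-1}$. Let $\Delta_d\in\mathbb{C}[A]$ be the discriminant of the characteristic polynomial of $\rho_d(A)$, and let $\Delta=\Delta_1$ be the discriminant of the characteristic polynomial of $A$. Proposition. (1) For every $f\in\mathbb{C}[x]_d$, every irreducible factor of $\Delta_d$ in $\mathbb{C}[A]$ divides $\det K_d(f)$ or $\Delta$. (2) The irreducible factors of $\det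 K_d(f)$ that are independent of $f$ are exactly the irreducible factors of $\Delta_d$ other than $\Delta$: an irreducible $q\in\mathbb{C}[A]$ divides $\det K_d(f)$ for all $f\in\mathbb{C}[x]_d$ if and only if $q$ divides $\Delta_d$ and $q$ is not a scalar multiple of $\Delta$. -/

import Mathlib

open MvPolynomial

noncomputable section

/-- The exponent vectors of the monomials of degree `d` in `n` variables. They index the monomial
basis of the space of homogeneous polynomials of degree `d`. -/
abbrev Exponents (n d : ℕ) : Type := {α : Fin n →₀ ℕ // α.degree = d}

/-- Degree `d` exponent vectors correspond to multisets of size `d`. -/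
def exponentsEquivSym (n d : ℕ) : Exponents n d ≃ Sym (Fin n) d :=
  (Equiv.subtypeEquivRight fun α => by
    rw [Finsupp.degree_eq_sum, Finsupp.sum_fintype _ _ (fun _ => rfl)]; rfl).trans
    (Sym.equivNatSum (Fin n) d).symm

instance (n d : ℕ) : Fintype (Exponents n d) := Fintype.ofEquiv _ (exponentsEquivSym n d).symm

/-- The dimension `N` of the space of homogeneous polynomials of degree `d` in `n` variables. -/
abbrev numMonomials (n d : ℕ) : ℕ := (n - 1 + d).choose d

/-- There are `N` monomials of degree `d`, so they can be listed as a sequence of length `N`. -/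
theorem card_exponents (n d : ℕ) (hn : 0 < n) :
    Fintype.card (Exponents n d) = numMonomials n d := by
  rw [Fintype.card_congr (exponentsEquivSym n d), Sym.card_sym_eq_choose, Fintype.card_fin,
    numMonomials, Nat.sub_add_comm hn]

/-- The `d`-th symmetric power of the matrix `A`, written in the monomial basis: the row with
index `α` consists of the coefficients of `(A x)^α = ∏ i, ((A x)_i) ^ (α i)`. -/
def symPower {R : Type*} [CommRing R] {n : ℕ} (d : ℕ) (A : Matrix (Fin n) (Fin n) R) :
    Matrix (Exponents n d) (Exponents n d) R :=
  Matrix.of fun α β =>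
    coeff β.1 (∏ i : Fin n, (∑ j : Fin n, C (A i j) * X j : MvPolynomial (Fin n) R) ^ (α.1 i))

/-- The ring `ℂ[A]` of polynomials in the entries `a_ij` of an `n × n` matrix. -/
abbrev EntryRing (n : ℕ) : Type := MvPolynomial (Fin n × Fin n) ℂ

/-- The matrix `A = (a_ij)` filled with variables. -/
abbrev genericMatrix (n : ℕ) : Matrix (Fin n) (Fin n) (EntryRing n) :=
  Matrix.mvPolynomialX (Fin n) (Fin n) ℂ

/-- The row vector `C_f` of the coefficients of the degree `d` form `f`, seen in `ℂ[A]`. -/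
def coeffRow {n : ℕ} (d : ℕ) (f : MvPolynomial (Fin n) ℂ) : Exponents n d → EntryRing n :=
  fun α => C (coeff α.1 f)

/-- The Kalman matrix `K_d(f)` of order `d`: the square matrix of size `N` with rows
`C_f`, `C_f ρ_d(A)`, …, `C_f ρ_d(A) ^ (N - 1)`. Its columns are put in the order `e` of the
monomials. -/
def kalmanMatrix {n d : ℕ} (e : Fin (numMonomials n d) ≃ Exponents n d)
    (f : MvPolynomial (Fin n) ℂ) :
    Matrix (Fin (numMonomials n d)) (Fin (numMonomials n d)) (EntryRing n) :=
  Matrix.of fun k j => Matrix.vecMul (coeffRow d f) (symPower d (genericMatrix n) ^ (k : ℕ)) (e j)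

/-- `Δ_d`: the discriminant of the characteristic polynomial of `ρ_d(A)`. -/
def discrSymPower (n d : ℕ) : EntryRing n := (symPower d (genericMatrix n)).charpoly.discr

/-- `Δ`: the discriminant of the characteristic polynomial of `A`. -/
def discrGeneric (n : ℕ) : EntryRing n := (genericMatrix n).charpoly.discr

end

/-! For an irreducible `q`, let `K` be an algebraic closure of the fraction field of `ℂ[A]/(q)`.
Divisibility by `q` becomes vanishing at one matrix over `K` (`exists_algHom_ker_eq_span`), so
linear algebra over `K` applies.

If `S = P D P⁻¹` with `D` diagonal, the rows `v S^k` form a matrix with determinant Vandermonde(D) ·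
∏ (vP)_i · det P⁻¹. When `Δ ≠ 0` at this point, `A` is diagonalizable, hence so is `ρ_d(A)`; if
moreover `Δ_d = 0`, the Vandermonde factor vanishes. This gives (1) and half of (2)
(`dvd_det_kalmanMatrix`). When `Δ_d ≠ 0`, the determinant is a nonzero polynomial in `v`, so some
complex `f` keeps it nonzero (`dvd_discrSymPower`).

Two facts about `Δ` remain for `n ≥ 2`. It does not divide every `det K_d(f)`: a Jordan type matrix
with otherwise generic eigenvalues kills `Δ`, yet its symmetric power has a cyclic row vector
(`exists_not_discrGeneric_dvd`). And it is irreducible (`associated_discrGeneric_of_dvd`): matrices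
with a repeated eigenvalue are parametrized by polynomials, so all irreducible factors of `Δ` are
associated to one prime, and a curve on which `Δ` vanishes to minimal order excludes a square. -/

noncomputable section

/-! ### Discriminants of monic polynomials and diagonalization -/

theorem discr_eq_resultant {R : Type*} [CommRing R] {p : Polynomial R} (hp : p.Monic)
    (hdeg : 0 < p.natDegree) :
    p.discr = (-1) ^ (p.natDegree * (p.natDegree - 1) / 2) *
      p.resultant (Polynomial.derivative p) p.natDegree (p.natDegree - 1) := by
  rw [Polynomial.resultant_deriv (Polynomial.natDegree_pos_iff_degree_pos.1 hdeg), hp.leadingCoeff,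
    mul_one, ← mul_assoc, ← mul_pow]
  simp

/-- The resultant is taken in the formal degrees `n` and `n - 1`, so it commutes with ring maps even
when the derivative loses degree. -/
theorem discr_map_of_monic {R S : Type*} [CommRing R] [CommRing S] [Nontrivial S]
    {p : Polynomial R} (hp : p.Monic) (hdeg : 0 < p.natDegree) (φ : R →+* S) :
    (p.map φ).discr = φ p.discr := by
  have h := hp.natDegree_map φ
  rw [discr_eq_resultant (hp.map φ) (by rwa [h]), discr_eq_resultant hp hdeg, h,
    Polynomial.derivative_map, Polynomial.resultant_map_map]
  simp

theorem discr_charpoly_map {R S ι : Type*} [CommRing R] [CommRing S] [Nontrivial S]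
    [Fintype ι] [DecidableEq ι] [Nonempty ι] (A : Matrix ι ι R) (φ : R →+* S) :
    (A.map φ).charpoly.discr = φ A.charpoly.discr := by
  have := φ.domain_nontrivial
  rw [Matrix.charpoly_map]
  exact discr_map_of_monic A.charpoly_monic
    (by rw [Matrix.charpoly_natDegree_eq_dim]; exact Fintype.card_pos) φ

theorem discr_ne_zero_iff_separable {K : Type*} [Field K] {p : Polynomial K} (hp : p.Monic)
    (hdeg : 0 < p.natDegree) : p.discr ≠ 0 ↔ p.Separable := by
  have key : p.discr ≠ 0 ↔ p.resultant (Polynomial.derivative p) p.natDegree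
      (p.natDegree - 1) ≠ 0 := by
    rw [discr_eq_resultant hp hdeg]
    simp
  -- Here `k` is the drop in degree of the derivative below `n - 1`, possible in positive
  -- characteristic; it contributes only a power of the leading coefficient 1.
  obtain ⟨k, hk⟩ := Nat.exists_eq_add_of_le (Polynomial.natDegree_derivative_le p)
  have hp' := hp.leadingCoeff
  rw [Polynomial.leadingCoeff] at hp'
  rw [key, hk, Polynomial.resultant_add_right_deg _ _ _ _ k le_rfl, hp', one_pow, one_mul, Ne,
    Polynomial.resultant_eq_zero_iff, Polynomial.separable_def]
  simp [hp.ne_zero]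

theorem discr_prod_X_sub_C_ne_zero_iff {K ι : Type*} [Field K] [Fintype ι] [Nonempty ι]
    (r : ι → K) :
    (∏ i, (Polynomial.X - Polynomial.C (r i))).discr ≠ 0 ↔ Function.Injective r := by
  rw [discr_ne_zero_iff_separable (Polynomial.monic_prod_X_sub_C r _)
    (by rw [Polynomial.natDegree_finsetProd_X_sub_C_eq_card]; exact Fintype.card_pos)]
  exact Polynomial.separable_prod_X_sub_C_iff

theorem charpoly_conj_of_mul_eq_one {R ι : Type*} [CommRing R] [Fintype ι] [DecidableEq ι]
    {P Q D : Matrix ι ι R} (h : P * Q = 1) : (P * D * Q).charpoly = D.charpoly := by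
  rw [Matrix.charpoly_mul_comm, ← mul_assoc, mul_eq_one_comm.1 h, one_mul]

/-- The resultant of `p` and `p'` is the product of the values of `p'` at the roots, and `p'(r i)`
is the product of the `r i - r j` with `j ≠ i`. -/
theorem discr_prod_X_sub_C {R ι : Type*} [CommRing R] [IsDomain R] [Fintype ι] [DecidableEq ι]
    [Nonempty ι] (r : ι → R) :
    ∃ k : ℕ, (∏ i, (Polynomial.X - Polynomial.C (r i))).discr =
      (-1) ^ k * ∏ i, ∏ j ∈ Finset.univ.erase i, (r i - r j) := by
  have hm := Polynomial.monic_prod_X_sub_C r Finset.univ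
  have hroots : (∏ i, (Polynomial.X - Polynomial.C (r i))).roots = Finset.univ.val.map r := by
    rw [← Polynomial.roots_multiset_prod_X_sub_C (Finset.univ.val.map r), Multiset.map_map]
    rfl
  rw [discr_eq_resultant hm (by
    rw [Polynomial.natDegree_finsetProd_X_sub_C_eq_card]; exact Fintype.card_pos)]
  refine ⟨_, congrArg _ ?_⟩
  rw [Polynomial.resultant_eq_prod_eval _ _ _ (Polynomial.natDegree_derivative_le _)
    (Polynomial.Splits.prod fun i _ => Polynomial.Splits.X_sub_C _), hm.leadingCoeff, one_pow,
    one_mul, hroots, Multiset.map_map]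
  refine Finset.prod_congr rfl fun i _ => ?_
  simp only [Function.comp]
  rw [Polynomial.derivative_prod_finset, Polynomial.eval_finsetSum,
    Finset.sum_eq_single i]
  · simp [Polynomial.eval_prod]
  · intro j _ hj
    rw [Polynomial.eval_mul, Polynomial.eval_prod,
      Finset.prod_eq_zero (i := i) (by simp [hj.symm]) (by simp), zero_mul]
  · simp

/-- A square matrix over an algebraically closed field with nonzero discriminant is diagonalizable
with distinct eigenvalues. -/
theorem exists_diagonalization {K ι : Type*} [Field K] [IsAlgClosed K] [Fintype ι] [DecidableEq ι]
    [Nonempty ι] (A : Matrix ι ι K) (hA : A.charpoly.discr ≠ 0) :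
    ∃ (P Q : Matrix ι ι K) (D : ι → K), P * Q = 1 ∧ A = P * Matrix.diagonal D * Q ∧
      Function.Injective D := by
  classical
  have hdeg : A.charpoly.natDegree = Fintype.card ι := A.charpoly_natDegree_eq_dim
  have hsep := (discr_ne_zero_iff_separable A.charpoly_monic
    (by rw [hdeg]; exact Fintype.card_pos)).1 hA
  have hcard : A.charpoly.roots.toFinset.card = Fintype.card ι := by
    rw [Multiset.toFinset_card_of_nodup (Polynomial.nodup_roots hsep), ← hdeg]
    exact (IsAlgClosed.splits A.charpoly).natDegree_eq_card_roots.symm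
  let r : ι ≃ A.charpoly.roots.toFinset := Fintype.equivOfCardEq (by simp [hcard])
  have hr : Function.Injective fun i => (r i : K) := Subtype.val_injective.comp r.injective
  have hev : ∀ i, Module.End.HasEigenvalue (Matrix.toLin' A) (r i : K) := fun i => by
    rw [Module.End.hasEigenvalue_iff_isRoot_charpoly, Matrix.charpoly_toLin']
    exact Polynomial.isRoot_of_mem_roots (Multiset.mem_toFinset.1 (r i).2)
  choose v hv using fun i => (hev i).exists_hasEigenvector
  have hli := Module.End.eigenvectors_linearIndependent' (Matrix.toLin' A) _ hr v hv
  let P : Matrix ι ι K := Matrix.of fun i j => v j i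
  have hP : IsUnit P := by
    rw [← Matrix.linearIndependent_cols_iff_isUnit]
    exact hli
  have hAP : A * P = P * Matrix.diagonal fun i => (r i : K) := by
    ext i j
    have := congrFun (hv j).apply_eq_smul i
    rw [Matrix.mul_diagonal]
    simpa [Matrix.mulVec, dotProduct, Matrix.mul_apply, P, mul_comm] using this
  have hPQ : P * P⁻¹ = 1 := Matrix.mul_nonsing_inv P ((Matrix.isUnit_iff_isUnit_det P).1 hP)
  exact ⟨P, P⁻¹, _, hPQ, by rw [← hAP, mul_assoc, hPQ, mul_one], hr⟩

/-! ### Symmetric powers as linear substitutions -/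

/-- The substitution `x ↦ A x`. -/
def linearSubst {R : Type*} [CommRing R] {n : ℕ} (A : Matrix (Fin n) (Fin n) R) :
    MvPolynomial (Fin n) R →ₐ[R] MvPolynomial (Fin n) R :=
  aeval fun i => ∑ j, C (A i j) * X j

theorem symPower_apply {R : Type*} [CommRing R] {n d : ℕ} (A : Matrix (Fin n) (Fin n) R)
    (α β : Exponents n d) :
    symPower d A α β = coeff β.1 (linearSubst A (monomial α.1 1)) := by
  rw [linearSubst, aeval_monomial, Finsupp.prod_fintype _ _ (fun _ => pow_zero _)]
  simp [symPower]

theorem linearSubst_comp {R : Type*} [CommRing R] {n : ℕ} (A B : Matrix (Fin n) (Fin n) R) :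
    (linearSubst B).comp (linearSubst A) = linearSubst (A * B) := by
  ext i : 1
  simp only [linearSubst, AlgHom.comp_apply, aeval_X, map_sum, map_mul, algHom_C, algebraMap_eq,
    Matrix.mul_apply, Finset.mul_sum, Finset.sum_mul]
  rw [Finset.sum_comm]
  simp [mul_assoc]

theorem linearSubst_isHomogeneous {R : Type*} [CommRing R] {n d : ℕ}
    (A : Matrix (Fin n) (Fin n) R) {f : MvPolynomial (Fin n) R} (hf : f.IsHomogeneous d) :
    (linearSubst A f).IsHomogeneous d := by
  have := hf.aeval (n := 1) (fun i => ∑ j, C (A i j) * X j)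
    (fun i => IsHomogeneous.sum _ _ _ fun j _ => isHomogeneous_C_mul_X _ _)
  rwa [one_mul] at this

theorem sum_monomial_coeff {R : Type*} [CommRing R] {n d : ℕ} {f : MvPolynomial (Fin n) R}
    (hf : f.IsHomogeneous d) : ∑ α : Exponents n d, monomial α.1 (coeff α.1 f) = f := by
  ext β
  rw [coeff_sum]
  simp only [coeff_monomial]
  by_cases hβ : β.degree = d
  · rw [Finset.sum_eq_single ⟨β, hβ⟩]
    · simp
    · intro α _ hα
      rw [if_neg fun h => hα (Subtype.ext h)]
    · simp
  · rw [hf.coeff_eq_zero hβ]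
    refine Finset.sum_eq_zero fun α _ => if_neg fun h : α.1 = β => hβ (h ▸ α.2)

/-- The rows of `symPower d A` are the images of the monomials, so acting on coefficient rows from
the right is substitution. Multiplicativity of `symPower` then follows from composing substitutions.
-/
theorem vecMul_symPower {R : Type*} [CommRing R] {n d : ℕ} (A : Matrix (Fin n) (Fin n) R)
    {f : MvPolynomial (Fin n) R} (hf : f.IsHomogeneous d) :
    Matrix.vecMul (fun α : Exponents n d => coeff α.1 f) (symPower d A) =
      fun β => coeff β.1 (linearSubst A f) := by
  ext β
  conv_rhs => rw [← sum_monomial_coeff hf, map_sum, coeff_sum]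
  refine Finset.sum_congr rfl fun α _ => ?_
  dsimp only
  rw [symPower_apply, ← smul_eq_mul, ← coeff_smul, ← map_smul, smul_monomial, smul_eq_mul, mul_one]

theorem symPower_mul {R : Type*} [CommRing R] {n d : ℕ} (A B : Matrix (Fin n) (Fin n) R) :
    symPower d (A * B) = symPower d A * symPower d B := by
  ext α β
  have h := congrFun (vecMul_symPower B (linearSubst_isHomogeneous A
    (isHomogeneous_monomial (1 : R) α.2))) β
  rw [← AlgHom.comp_apply, linearSubst_comp, ← symPower_apply] at h
  rw [← h, Matrix.mul_apply]
  simp only [Matrix.vecMul, dotProduct, symPower_apply]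

theorem symPower_diagonal {R : Type*} [CommRing R] {n d : ℕ} (D : Fin n → R) :
    symPower d (Matrix.diagonal D) =
      Matrix.diagonal fun α : Exponents n d => ∏ i, D i ^ α.1 i := by
  ext α β
  have h : linearSubst (Matrix.diagonal D) (monomial α.1 1) =
      monomial α.1 (∏ i, D i ^ α.1 i) := by
    rw [linearSubst, aeval_monomial, Finsupp.prod_fintype _ _ (fun _ => pow_zero _),
      monomial_eq, Finsupp.prod_fintype _ _ (fun _ => pow_zero _)]
    have : ∀ i, ∑ j, C (Matrix.diagonal D i j) * X j = (C (D i) * X i : MvPolynomial (Fin n) R) :=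
      fun i => by simp [Matrix.diagonal_apply, apply_ite C, ite_mul]
    simp [this, mul_pow, Finset.prod_mul_distrib]
  rw [symPower_apply, h, coeff_monomial, Matrix.diagonal_apply]
  simp only [Subtype.ext_iff]

theorem symPower_one {R : Type*} [CommRing R] {n d : ℕ} :
    symPower d (1 : Matrix (Fin n) (Fin n) R) = 1 := by
  rw [← Matrix.diagonal_one, symPower_diagonal]
  simp

theorem symPower_pow {R : Type*} [CommRing R] {n d : ℕ} (A : Matrix (Fin n) (Fin n) R) (k : ℕ) :
    symPower d (A ^ k) = symPower d A ^ k := by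
  induction k with
  | zero => simp [symPower_one]
  | succ k ih => rw [pow_succ, symPower_mul, ih, pow_succ]

theorem symPower_map {R S : Type*} [CommRing R] [CommRing S] {n d : ℕ}
    (A : Matrix (Fin n) (Fin n) R) (φ : R →+* S) :
    (symPower d A).map φ = symPower d (A.map φ) := by
  ext α β
  simp only [symPower, Matrix.map_apply, Matrix.of_apply]
  rw [← coeff_map]
  simp [map_prod, map_sum, map_pow]

/-! ### Krylov matrices of diagonalizable matrices -/

/-- The matrix with rows `v`, `v S`, `v S ^ 2`, … -/
def krylovMatrix {R ι : Type*} [CommRing R] [Fintype ι] [DecidableEq ι] {N : ℕ} (e : Fin N ≃ ι)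
    (S : Matrix ι ι R) (v : ι → R) : Matrix (Fin N) (Fin N) R :=
  Matrix.of fun k j => Matrix.vecMul v (S ^ (k : ℕ)) (e j)

theorem krylovMatrix_map {R R' ι : Type*} [CommRing R] [CommRing R'] [Fintype ι] [DecidableEq ι]
    {N : ℕ} (e : Fin N ≃ ι) (S : Matrix ι ι R) (v : ι → R) (φ : R →+* R') :
    (krylovMatrix e S v).map φ = krylovMatrix e (S.map φ) (φ ∘ v) := by
  ext k j
  simp only [krylovMatrix, Matrix.map_apply, Matrix.of_apply, Matrix.vecMul, dotProduct, map_sum,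
    map_mul, Function.comp]
  refine Finset.sum_congr rfl fun i _ => ?_
  have h := congrFun (congrFun (Matrix.map_pow S φ k) i) (e j)
  rw [Matrix.map_apply] at h
  rw [h]

theorem pow_conj_diagonal {R ι : Type*} [CommRing R] [Fintype ι] [DecidableEq ι]
    {P Q : Matrix ι ι R} (h : P * Q = 1) (D : ι → R) (k : ℕ) :
    (P * Matrix.diagonal D * Q) ^ k = P * Matrix.diagonal (fun i => D i ^ k) * Q := by
  have h' : Q * P = 1 := mul_eq_one_comm.1 h
  induction k with
  | zero => simp [h]
  | succ k ih =>
    rw [pow_succ, ih]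
    calc _ = P * Matrix.diagonal (fun i => D i ^ k) * (Q * P) * Matrix.diagonal D * Q := by
          simp only [mul_assoc]
      _ = _ := by
          rw [h', mul_one, mul_assoc P, Matrix.diagonal_mul_diagonal]
          simp only [pow_succ]

/-- Row `k` is `(vP) D^k Q`, so the matrix factors as transposed Vandermonde times `diag(vP)` times
`Q`, up to reindexing. -/
theorem det_krylovMatrix_conj_diagonal {R ι : Type*} [CommRing R] [Fintype ι] [DecidableEq ι]
    {N : ℕ} (e : Fin N ≃ ι) {P Q : Matrix ι ι R} (h : P * Q = 1) (D v : ι → R) :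
    (krylovMatrix e (P * Matrix.diagonal D * Q) v).det =
      (Matrix.vandermonde (D ∘ e)).det * (∏ i, Matrix.vecMul v P i) * Q.det := by
  have key : krylovMatrix e (P * Matrix.diagonal D * Q) v =
      (Matrix.vandermonde (D ∘ e)).transpose * Matrix.diagonal (Matrix.vecMul v P ∘ e) *
        Q.submatrix e e := by
    ext k j
    rw [krylovMatrix, Matrix.of_apply, pow_conj_diagonal h, ← Matrix.vecMul_vecMul,
      ← Matrix.vecMul_vecMul, Matrix.mul_apply]
    simp only [Matrix.mul_diagonal, Matrix.transpose_apply, Matrix.vandermonde_apply,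
      Matrix.submatrix_apply, Function.comp]
    rw [Matrix.vecMul, dotProduct, ← Equiv.sum_comp e]
    refine Finset.sum_congr rfl fun i _ => ?_
    rw [Matrix.vecMul_diagonal, mul_comm (D (e i) ^ (k : ℕ))]
  rw [key, Matrix.det_mul, Matrix.det_mul, Matrix.det_transpose, Matrix.det_diagonal,
    Matrix.det_submatrix_equiv_self]
  congr 2
  exact Equiv.prod_comp e _

/-! ### Specialization to matrices over algebraically closed fields -/

theorem map_genericMatrix_symPower {R : Type*} [CommRing R] [Algebra ℂ R] {n d : ℕ}
    (φ : EntryRing n →ₐ[ℂ] R) :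
    (symPower d (genericMatrix n)).map φ = symPower d ((genericMatrix n).map φ) :=
  symPower_map (genericMatrix n) (φ : EntryRing n →+* R)

theorem map_det_kalmanMatrix {R : Type*} [CommRing R] [Algebra ℂ R] {n d : ℕ}
    (e : Fin (numMonomials n d) ≃ Exponents n d) (f : MvPolynomial (Fin n) ℂ)
    (φ : EntryRing n →ₐ[ℂ] R) :
    φ (kalmanMatrix e f).det = (krylovMatrix e (symPower d ((genericMatrix n).map φ))
      fun α => algebraMap ℂ R (coeff α.1 f)).det := by
  have h := krylovMatrix_map e (symPower d (genericMatrix n)) (coeffRow d f)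
    (φ : EntryRing n →+* R)
  have h2 : (krylovMatrix e (symPower d (genericMatrix n)) (coeffRow d f)) = kalmanMatrix e f :=
    rfl
  rw [h2] at h
  rw [AlgHom.map_det, AlgHom.mapMatrix_apply]
  refine congrArg Matrix.det (h.trans ?_)
  congr 1
  · exact map_genericMatrix_symPower φ
  · ext α
    exact φ.commutes (coeff α.1 f)

theorem exponents_nonempty {n : ℕ} (hn : 0 < n) (d : ℕ) : Nonempty (Exponents n d) :=
  ⟨⟨Finsupp.single ⟨0, hn⟩ d, by simp⟩⟩

theorem map_discrGeneric {R : Type*} [CommRing R] [Nontrivial R] [Algebra ℂ R] {n : ℕ}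
    (hn : 0 < n) (φ : EntryRing n →ₐ[ℂ] R) :
    φ (discrGeneric n) = ((genericMatrix n).map φ).charpoly.discr := by
  have : Nonempty (Fin n) := ⟨⟨0, hn⟩⟩
  exact (discr_charpoly_map (genericMatrix n) (φ : EntryRing n →+* R)).symm

theorem map_discrSymPower {R : Type*} [CommRing R] [Nontrivial R] [Algebra ℂ R] {n d : ℕ}
    (hn : 0 < n) (φ : EntryRing n →ₐ[ℂ] R) :
    φ (discrSymPower n d) = (symPower d ((genericMatrix n).map φ)).charpoly.discr := by
  have := exponents_nonempty hn d
  rw [← map_genericMatrix_symPower]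
  exact (discr_charpoly_map (symPower d (genericMatrix n)) (φ : EntryRing n →+* R)).symm

theorem map_det_kalmanMatrix_eq_zero {K : Type*} [Field K] [IsAlgClosed K] [Algebra ℂ K] {n d : ℕ}
    (hn : 0 < n) (e : Fin (numMonomials n d) ≃ Exponents n d) (f : MvPolynomial (Fin n) ℂ)
    (φ : EntryRing n →ₐ[ℂ] K) (h1 : φ (discrGeneric n) ≠ 0) (hd : φ (discrSymPower n d) = 0) :
    φ (kalmanMatrix e f).det = 0 := by
  have : Nonempty (Fin n) := ⟨⟨0, hn⟩⟩
  have := exponents_nonempty hn d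
  rw [map_discrGeneric hn] at h1
  obtain ⟨P, Q, D, hPQ, hA, -⟩ := exists_diagonalization _ h1
  have hS : symPower d P * symPower d Q = 1 := by rw [← symPower_mul, hPQ, symPower_one]
  rw [map_discrSymPower hn, hA, symPower_mul, symPower_mul, symPower_diagonal,
    charpoly_conj_of_mul_eq_one hS, Matrix.charpoly_diagonal] at hd
  rw [map_det_kalmanMatrix, hA, symPower_mul, symPower_mul, symPower_diagonal,
    det_krylovMatrix_conj_diagonal e hS]
  have hinj := mt (discr_prod_X_sub_C_ne_zero_iff _).2 (not_not.2 hd)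
  rw [not_not.1 (mt Matrix.det_vandermonde_ne_zero_iff.1 fun h =>
    hinj ((Equiv.injective_comp e _).1 h)), zero_mul, zero_mul]

theorem exists_map_det_kalmanMatrix_ne_zero {K : Type*} [Field K] [IsAlgClosed K] [Algebra ℂ K]
    {n d : ℕ} (hn : 0 < n) (e : Fin (numMonomials n d) ≃ Exponents n d)
    (φ : EntryRing n →ₐ[ℂ] K) (hd : φ (discrSymPower n d) ≠ 0) :
    ∃ f : MvPolynomial (Fin n) ℂ, f.IsHomogeneous d ∧ φ (kalmanMatrix e f).det ≠ 0 := by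
  have := exponents_nonempty hn d
  by_contra! hcon
  rw [map_discrSymPower hn] at hd
  set S := symPower d ((genericMatrix n).map φ)
  obtain ⟨P, Q, D, hPQ, hS, hD⟩ := exists_diagonalization S hd
  -- The determinant as a polynomial in an indeterminate row vector. Vanishing for all complex forms
  -- forces it to be zero, because the image of `ℂ` in `K` is infinite.
  let p : MvPolynomial (Exponents n d) K := (krylovMatrix e (S.map C) X).det
  have hp : ∀ v, eval v p = (krylovMatrix e S v).det := fun v => by
    rw [RingHom.map_det, RingHom.mapMatrix_apply, krylovMatrix_map]
    congr 2
    · ext; simp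
    · ext; simp
  have hp0 : p = 0 := by
    refine funext_set (fun _ => Set.range (algebraMap ℂ K))
      (fun _ => Set.infinite_range_of_injective (algebraMap ℂ K).injective) fun v hv => ?_
    choose c hc using fun α => hv α trivial
    let f : MvPolynomial (Fin n) ℂ := ∑ α : Exponents n d, monomial α.1 (c α)
    have hf : f.IsHomogeneous d := IsHomogeneous.sum _ _ _ fun α _ => isHomogeneous_monomial _ α.2
    have h := hcon f hf
    rw [map_det_kalmanMatrix] at h
    rw [hp, map_zero, ← h]
    congr 2
    ext α
    rw [← hc α]
    congr 1
    rw [coeff_sum, Finset.sum_eq_single α]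
    · simp
    · intro β _ hβ
      rw [coeff_monomial, if_neg fun h => hβ (Subtype.ext h)]
    · simp
  -- For `v = (1, …, 1) Q` the row `vP` is `(1, …, 1)`, so no factor of the determinant vanishes.
  have h := hp (Matrix.vecMul 1 Q)
  rw [hp0, map_zero, hS, det_krylovMatrix_conj_diagonal e hPQ, Matrix.vecMul_vecMul,
    mul_eq_one_comm.1 hPQ, Matrix.vecMul_one] at h
  have hQ : Q.det ≠ 0 := fun h0 => by
    simpa [h0] using congrArg Matrix.det hPQ
  have hV : (Matrix.vandermonde (D ∘ e)).det ≠ 0 :=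
    Matrix.det_vandermonde_ne_zero_iff.2 (hD.comp e.injective)
  simp [hQ, hV] at h

/-- This is the generic point of the hypersurface `q = 0`; the ideal `(q)` is prime because `ℂ[A]`
is factorial. -/
theorem exists_algHom_ker_eq_span {n : ℕ} {q : EntryRing n} (hq : Irreducible q) :
    ∃ (K : Type) (_ : Field K) (_ : IsAlgClosed K) (_ : Algebra ℂ K) (φ : EntryRing n →ₐ[ℂ] K),
      ∀ p, φ p = 0 ↔ q ∣ p := by
  have hprime : (Ideal.span {q}).IsPrime :=
    (Ideal.span_singleton_prime hq.ne_zero).2 hq.prime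
  let B := EntryRing n ⧸ Ideal.span {q}
  let F := FractionRing B
  refine ⟨AlgebraicClosure F, inferInstance, inferInstance, inferInstance,
    (IsScalarTower.toAlgHom ℂ B (AlgebraicClosure F)).comp (Ideal.Quotient.mkₐ ℂ _), fun p => ?_⟩
  rw [AlgHom.comp_apply, IsScalarTower.coe_toAlgHom',
    IsScalarTower.algebraMap_apply B F (AlgebraicClosure F), map_eq_zero,
    map_eq_zero_iff _ (IsFractionRing.injective B F), Ideal.Quotient.mkₐ_eq_mk,
    Ideal.Quotient.eq_zero_iff_mem, Ideal.mem_span_singleton]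

theorem dvd_det_kalmanMatrix {n d : ℕ} (hn : 0 < n) (e : Fin (numMonomials n d) ≃ Exponents n d)
    (f : MvPolynomial (Fin n) ℂ) {q : EntryRing n} (hq : Irreducible q)
    (hd : q ∣ discrSymPower n d) (h1 : ¬ q ∣ discrGeneric n) : q ∣ (kalmanMatrix e f).det := by
  obtain ⟨K, _, _, _, φ, hφ⟩ := exists_algHom_ker_eq_span hq
  rw [← hφ] at hd h1 ⊢
  exact map_det_kalmanMatrix_eq_zero hn e f φ h1 hd

theorem dvd_discrSymPower {n d : ℕ} (hn : 0 < n) (e : Fin (numMonomials n d) ≃ Exponents n d)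
    {q : EntryRing n} (hq : Irreducible q)
    (h : ∀ f : MvPolynomial (Fin n) ℂ, f.IsHomogeneous d → q ∣ (kalmanMatrix e f).det) :
    q ∣ discrSymPower n d := by
  obtain ⟨K, _, _, _, φ, hφ⟩ := exists_algHom_ker_eq_span hq
  by_contra hd
  rw [← hφ] at hd
  obtain ⟨f, hf, hne⟩ := exists_map_det_kalmanMatrix_ne_zero hn e φ hd
  exact hne ((hφ _).2 (h f hf))

/-! ### A cyclic vector for the symmetric power of a Jordan type matrix -/

/-- The Jordan type matrix with diagonal `c` and the entry `c 0` in position `(0, 1)`. -/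
def jordanMatrix {R : Type*} [CommRing R] {m : ℕ} (c : Fin (m + 2) → R) :
    Matrix (Fin (m + 2)) (Fin (m + 2)) R :=
  Matrix.diagonal c + Matrix.single 0 1 (c 0)

/-- The leading block is `c 0` times a unipotent block, which is why the corner entry is `k * c 0 ^
k`, with no exponent `k - 1`. -/
theorem jordanMatrix_pow {R : Type*} [CommRing R] {m : ℕ} (c : Fin (m + 2) → R) (hc : c 1 = c 0)
    (k : ℕ) : jordanMatrix c ^ k =
      Matrix.diagonal (fun i => c i ^ k) + Matrix.single 0 1 (k * c 0 ^ k) := by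
  induction k with
  | zero => simp
  | succ k ih =>
    rw [pow_succ, ih, jordanMatrix, add_mul, mul_add, mul_add, Matrix.diagonal_mul_diagonal,
      Matrix.single_mul_single_of_ne _ _ _ _ (by simp), add_zero, add_assoc]
    simp only [pow_succ]
    congr 1
    ext i j
    by_cases hi : i = 0 <;> by_cases hj : j = 1
    · subst hi hj
      simp [hc, add_mul, mul_assoc, add_comm]
    · simp [Ne.symm hj]
    · simp [Ne.symm hi]
    · simp [Ne.symm hi]

theorem charpoly_jordanMatrix {R : Type*} [CommRing R] {m : ℕ} (c : Fin (m + 2) → R) :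
    (jordanMatrix c).charpoly = ∏ i, (Polynomial.X - Polynomial.C (c i)) := by
  rw [Matrix.charpoly_of_isUpperTriangular]
  · refine Finset.prod_congr rfl fun i _ => ?_
    have : ¬ ((0 : Fin (m + 2)) = i ∧ 1 = i) := by
      rintro ⟨rfl, h⟩; simp at h
    simp [jordanMatrix, this]
  · intro i j hij
    have hij' : j < i := hij
    have : ¬ ((0 : Fin (m + 2)) = i ∧ 1 = j) := by
      rintro ⟨rfl, rfl⟩; simp at hij'
    simp [jordanMatrix, this, hij'.ne']

theorem discr_prod_X_sub_C_eq_zero {R ι : Type*} [CommRing R] [IsDomain R] [Fintype ι] (r : ι → R)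
    {i j : ι} (hij : i ≠ j) (h : r i = r j) :
    (∏ i, (Polynomial.X - Polynomial.C (r i))).discr = 0 := by
  classical
  have : Nonempty ι := ⟨i⟩
  obtain ⟨k, hk⟩ := discr_prod_X_sub_C r
  rw [hk, Finset.prod_eq_zero (Finset.mem_univ i)
    (Finset.prod_eq_zero (Finset.mem_erase.2 ⟨hij.symm, Finset.mem_univ j⟩) (by rw [h, sub_self])),
    mul_zero]

/-- The exponent vector obtained from `α` by substituting `x₁ ↦ x₀`. -/
def mergeExponent {m : ℕ} (α : Fin (m + 2) →₀ ℕ) : Fin (m + 2) →₀ ℕ :=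
  Finsupp.equivFunOnFinite.symm (Fin.cons (α 0 + α 1) (Fin.cons 0 fun i => α i.succ.succ))

/-- The exponent vector obtained from `β` by moving `j` from position `0` to position `1`. -/
def shiftExponent {m : ℕ} (β : Fin (m + 2) →₀ ℕ) (j : ℕ) : Fin (m + 2) →₀ ℕ :=
  Finsupp.equivFunOnFinite.symm (Fin.cons (β 0 - j) (Fin.cons j fun i => β i.succ.succ))

theorem mergeExponent_zero {m : ℕ} (α : Fin (m + 2) →₀ ℕ) : mergeExponent α 0 = α 0 + α 1 := rfl

theorem mergeExponent_one {m : ℕ} (α : Fin (m + 2) →₀ ℕ) : mergeExponent α 1 = 0 := rfl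

theorem mergeExponent_succ_succ {m : ℕ} (α : Fin (m + 2) →₀ ℕ) (i : Fin m) :
    mergeExponent α i.succ.succ = α i.succ.succ := rfl

theorem shiftExponent_zero {m : ℕ} (α : Fin (m + 2) →₀ ℕ) (j : ℕ) :
    shiftExponent α j 0 = α 0 - j := rfl

theorem shiftExponent_one {m : ℕ} (α : Fin (m + 2) →₀ ℕ) (j : ℕ) : shiftExponent α j 1 = j := rfl

theorem shiftExponent_succ_succ {m : ℕ} (α : Fin (m + 2) →₀ ℕ) (j : ℕ) (i : Fin m) :
    shiftExponent α j i.succ.succ = α i.succ.succ := rfl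

theorem finsupp_fin_ext {m : ℕ} {α β : Fin (m + 2) →₀ ℕ} (h0 : α 0 = β 0) (h1 : α 1 = β 1)
    (h : ∀ i : Fin m, α i.succ.succ = β i.succ.succ) : α = β := by
  ext i
  induction i using Fin.cases with
  | zero => exact h0
  | succ i =>
    induction i using Fin.cases with
    | zero => exact h1
    | succ i => exact h i

theorem degree_fin_add_two {m : ℕ} (α : Fin (m + 2) →₀ ℕ) :
    α.degree = α 0 + (α 1 + ∑ i : Fin m, α i.succ.succ) := by
  rw [Finsupp.degree_eq_sum, Fin.sum_univ_succ, Fin.sum_univ_succ]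
  rfl

theorem degree_mergeExponent {m : ℕ} (α : Fin (m + 2) →₀ ℕ) :
    (mergeExponent α).degree = α.degree := by
  rw [degree_fin_add_two, degree_fin_add_two]
  simp only [mergeExponent_zero, mergeExponent_one, mergeExponent_succ_succ]
  ring

theorem degree_shiftExponent {m : ℕ} {β : Fin (m + 2) →₀ ℕ} {j : ℕ} (hj : j ≤ β 0)
    (hβ : β 1 = 0) : (shiftExponent β j).degree = β.degree := by
  rw [degree_fin_add_two, degree_fin_add_two]
  simp only [shiftExponent_zero, shiftExponent_one, shiftExponent_succ_succ]
  lia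

/-- The shifts of `β` by `j ≤ β 0` run once through the fibre of `mergeExponent` over `β`, that is,
through the exponents whose eigenvalues are forced to agree by `c 1 = c 0`. -/
theorem shiftExponent_eq_iff {m : ℕ} {α β : Fin (m + 2) →₀ ℕ} {j : ℕ} (hj : j ≤ β 0)
    (hβ : β 1 = 0) : shiftExponent β j = α ↔ β = mergeExponent α ∧ j = α 1 := by
  constructor
  · rintro rfl
    refine ⟨finsupp_fin_ext ?_ ?_ fun i => ?_, rfl⟩
    · rw [mergeExponent_zero, shiftExponent_zero, shiftExponent_one]; lia
    · rw [mergeExponent_one, hβ]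
    · rw [mergeExponent_succ_succ, shiftExponent_succ_succ]
  · rintro ⟨rfl, rfl⟩
    refine finsupp_fin_ext ?_ ?_ fun i => ?_
    · rw [shiftExponent_zero, mergeExponent_zero]; lia
    · rw [shiftExponent_one]
    · rw [shiftExponent_succ_succ, mergeExponent_succ_succ]

theorem prod_pow_mergeExponent {R : Type*} [CommRing R] {m : ℕ} (c : Fin (m + 2) → R)
    (hc : c 1 = c 0) (α : Fin (m + 2) →₀ ℕ) :
    ∏ i, c i ^ mergeExponent α i = ∏ i, c i ^ α i := by
  simp only [Fin.prod_univ_succ (n := m + 1), Fin.prod_univ_succ (n := m),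
    mergeExponent_zero, mergeExponent_succ_succ, Fin.succ_zero_eq_one, mergeExponent_one, hc]
  ring

/-- The `k`-th power sends `x₀` to `c₀^k (x₀ + k x₁)` and scales the other variables occurring in
the monomial; the binomial theorem does the rest. -/
theorem linearSubst_jordanMatrix_pow {R : Type*} [CommRing R] {m : ℕ} (c : Fin (m + 2) → R)
    (hc : c 1 = c 0) (k : ℕ) (β : Fin (m + 2) →₀ ℕ) (hβ : β 1 = 0) :
    linearSubst (jordanMatrix c ^ k) (monomial β 1) =
      ∑ j ∈ Finset.range (β 0 + 1), monomial (shiftExponent β j)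
        ((∏ i, c i ^ β i) ^ k * (k ^ j * (β 0).choose j)) := by
  have h0 : ∑ j, C ((jordanMatrix c ^ k) 0 j) * X j =
      (C (c 0 ^ k) * (C (k : R) * X 1 + X 0) : MvPolynomial (Fin (m + 2)) R) := by
    rw [jordanMatrix_pow c hc, Fin.sum_univ_succ, Fin.sum_univ_succ, Finset.sum_eq_zero]
    · simp
      ring
    · intro i _
      rw [Matrix.add_apply, Matrix.diagonal_apply_ne _ (Fin.succ_ne_zero _).symm,
        Matrix.single_apply_of_ne (h := by simp [Fin.ext_iff])]
      simp
  have h1 : ∀ i : Fin (m + 1), ∑ j, C ((jordanMatrix c ^ k) i.succ j) * X j =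
      (C (c i.succ ^ k) * X i.succ : MvPolynomial (Fin (m + 2)) R) := fun i => by
    rw [jordanMatrix_pow c hc, Finset.sum_eq_single i.succ]
    · rw [Matrix.add_apply, Matrix.diagonal_apply_eq,
        Matrix.single_apply_of_ne (h := fun h => (Fin.succ_ne_zero i) h.1.symm), add_zero]
    · intro j _ hj
      rw [Matrix.add_apply, Matrix.diagonal_apply_ne _ hj.symm,
        Matrix.single_apply_of_ne (h := fun h => (Fin.succ_ne_zero i) h.1.symm)]
      simp
    · simp
  rw [linearSubst, aeval_monomial, Finsupp.prod_fintype _ _ (fun _ => pow_zero _),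
    Fin.prod_univ_succ, h0]
  simp only [h1]
  rw [mul_pow, add_pow, Finset.mul_sum, Finset.sum_mul, Finset.mul_sum]
  refine Finset.sum_congr rfl fun j _ => ?_
  rw [monomial_eq, Finsupp.prod_fintype _ _ (fun _ => pow_zero _)]
  simp only [Fin.prod_univ_succ (n := m + 1), Fin.prod_univ_succ (n := m), shiftExponent_zero,
    shiftExponent_succ_succ, Fin.succ_zero_eq_one, shiftExponent_one, hβ, mul_pow,
    Finset.prod_mul_distrib, map_mul, map_pow, map_prod, map_natCast, map_one, pow_zero,
    ← Finset.prod_pow]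
  simp only [pow_right_comm _ k]
  ring

theorem symPower_jordanMatrix_pow {R : Type*} [CommRing R] {m d : ℕ} (c : Fin (m + 2) → R)
    (hc : c 1 = c 0) (k : ℕ) (α β : Exponents (m + 2) d) (hβ : β.1 1 = 0) :
    symPower d (jordanMatrix c ^ k) β α = if β.1 = mergeExponent α.1 then
      (∏ i, c i ^ α.1 i) ^ k * (k ^ α.1 1 * (α.1 0 + α.1 1).choose (α.1 1)) else 0 := by
  rw [symPower_apply, linearSubst_jordanMatrix_pow c hc k β.1 hβ, coeff_sum]
  simp only [coeff_monomial]
  split_ifs with h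
  · have hlt : α.1 1 ∈ Finset.range (β.1 0 + 1) := by
      rw [h, mergeExponent_zero, Finset.mem_range]; lia
    rw [Finset.sum_eq_single_of_mem _ hlt, if_pos, h, prod_pow_mergeExponent c hc,
      mergeExponent_zero]
    · exact (shiftExponent_eq_iff (Finset.mem_range_succ_iff.1 hlt) hβ).2 ⟨h, rfl⟩
    · intro j hj hne
      exact if_neg fun h' =>
        hne ((shiftExponent_eq_iff (Finset.mem_range_succ_iff.1 hj) hβ).1 h').2
  · exact Finset.sum_eq_zero fun j hj => if_neg fun h' =>
      h ((shiftExponent_eq_iff (Finset.mem_range_succ_iff.1 hj) hβ).1 h').1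

/-- Among the monomials free of `x₁`, only the one with exponent `mergeExponent α` contributes to
coordinate `α`. The result is a column of a confluent Vandermonde matrix, up to a binomial factor.
-/
theorem vecMul_symPower_jordanMatrix_pow {R : Type*} [CommRing R] {m d : ℕ} (c : Fin (m + 2) → R)
    (hc : c 1 = c 0) (k : ℕ) (α : Exponents (m + 2) d) :
    Matrix.vecMul (fun β : Exponents (m + 2) d => if β.1 1 = 0 then 1 else 0)
      (symPower d (jordanMatrix c) ^ k) α =
      (∏ i, c i ^ α.1 i) ^ k * (k ^ α.1 1 * (α.1 0 + α.1 1).choose (α.1 1)) := by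
  rw [← symPower_pow, Matrix.vecMul, dotProduct,
    Finset.sum_eq_single ⟨mergeExponent α.1, (degree_mergeExponent _).trans α.2⟩]
  · rw [if_pos (mergeExponent_one _), symPower_jordanMatrix_pow c hc k _ _ (mergeExponent_one _),
      if_pos rfl, one_mul]
  · intro β _ hβ
    split_ifs with h
    · rw [symPower_jordanMatrix_pow c hc k _ _ h, if_neg fun h' => hβ (Subtype.ext h'), mul_zero]
    · rw [zero_mul]
  · simp

/-- The Euler operator `X d/dX` multiplies `X^k` by `k`, which accounts for the factors `k ^ α 1` in
the Krylov matrix. -/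
theorem iterate_X_mul_derivative_sum {R : Type*} [CommRing R] {N : ℕ} (v : Fin N → R) (j : ℕ) :
    (fun p : Polynomial R => Polynomial.X * Polynomial.derivative p)^[j]
      (∑ k, Polynomial.C (v k) * Polynomial.X ^ (k : ℕ)) =
      ∑ k, Polynomial.C (v k * (k : ℕ) ^ j) * Polynomial.X ^ (k : ℕ) := by
  induction j with
  | zero => simp
  | succ j ih =>
    rw [Function.iterate_succ_apply', ih]
    simp only [Polynomial.derivative_sum, Finset.mul_sum]
    refine Finset.sum_congr rfl fun k _ => ?_
    rw [Polynomial.derivative_C_mul_X_pow]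
    rcases k with ⟨_ | k, hk⟩
    · simp
    · simp only [Nat.add_sub_cancel, map_mul, map_pow, map_natCast]
      ring

/-- In characteristic zero, at a nonzero root of a nonzero polynomial, the Euler operator lowers the
multiplicity by exactly one. -/
theorem lt_rootMultiplicity_of_iterate {R : Type*} [CommRing R] [IsDomain R] [CharZero R] {μ : R}
    (hμ : μ ≠ 0) (s : ℕ) (p : Polynomial R) (hp : p ≠ 0)
    (h : ∀ j ≤ s, ((fun p : Polynomial R => Polynomial.X * Polynomial.derivative p)^[j] p).eval μ
      = 0) : s < p.rootMultiplicity μ := by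
  have h0 : p.IsRoot μ := h 0 (Nat.zero_le _)
  induction s generalizing p with
  | zero => exact (Polynomial.rootMultiplicity_pos hp).2 h0
  | succ s ih =>
    have hd : Polynomial.derivative p ≠ 0 := fun hd => by
      obtain ⟨a, rfl⟩ := Polynomial.natDegree_eq_zero.1
        (Polynomial.derivative_eq_zero.1 hd)
      rw [Polynomial.IsRoot, Polynomial.eval_C] at h0
      exact hp (by rw [h0, map_zero])
    have hne : Polynomial.X * Polynomial.derivative p ≠ 0 := mul_ne_zero Polynomial.X_ne_zero hd
    have := ih (Polynomial.X * Polynomial.derivative p) hne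
      (fun j hj => h (j + 1) (by lia)) (h 1 (by lia))
    rw [Polynomial.rootMultiplicity_mul hne,
      Polynomial.rootMultiplicity_eq_zero (p := Polynomial.X) (by simpa using hμ),
      Polynomial.derivative_rootMultiplicity_of_root h0] at this
    lia

/-- If no two eigenvalues `c^α` coincide except those forced by `c 1 = c 0`, then the symmetric
power of a Jordan type matrix has a cyclic vector. -/
theorem det_krylovMatrix_jordanMatrix_ne_zero {R : Type*} [CommRing R] [IsDomain R] [CharZero R]
    {m d N : ℕ} (e : Fin N ≃ Exponents (m + 2) d) (c : Fin (m + 2) → R) (hc : c 1 = c 0)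
    (hc0 : ∀ i, c i ≠ 0)
    (hinj : ∀ α β : Fin (m + 2) →₀ ℕ, ∏ i, c i ^ α i = ∏ i, c i ^ β i →
      mergeExponent α = mergeExponent β) :
    (krylovMatrix e (symPower d (jordanMatrix c)) fun β => if β.1 1 = 0 then 1 else 0).det ≠ 0 := by
  classical
  intro hdet
  obtain ⟨v, hv, hvK⟩ := Matrix.exists_vecMul_eq_zero_iff.2 hdet
  -- A left kernel vector becomes a nonzero polynomial of degree below `N`; column `α` says that an
  -- Euler derivative of it of order `α 1` vanishes at the eigenvalue `μ α`.
  let p : Polynomial R := ∑ k, Polynomial.C (v k) * Polynomial.X ^ (k : ℕ)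
  have hpdeg : p.degree < N := (Polynomial.degree_sum_fin_lt v)
  have hp : p ≠ 0 := fun h0 => hv (by
    ext k
    have := congrArg (fun p => Polynomial.coeff p k) h0
    simpa [p, Polynomial.finsetSum_coeff, Polynomial.coeff_C_mul, Polynomial.coeff_X_pow,
      Fin.val_inj] using this)
  let μ : Exponents (m + 2) d → R := fun α => ∏ i, c i ^ α.1 i
  have hμ : ∀ α, μ α ≠ 0 := fun α => Finset.prod_ne_zero_iff.2 fun i _ => pow_ne_zero _ (hc0 i)
  have heval : ∀ α : Exponents (m + 2) d,
      ((fun p : Polynomial R => Polynomial.X * Polynomial.derivative p)^[α.1 1] p).eval (μ α)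
        = 0 := fun α => by
    have h := congrFun hvK (e.symm α)
    simp only [Matrix.vecMul, dotProduct, krylovMatrix, Matrix.of_apply, Equiv.apply_symm_apply,
      Pi.zero_apply] at h
    have h2 : ∀ k : ℕ, ∑ β : Exponents (m + 2) d, (if β.1 1 = 0 then (1 : R) else 0) *
        (symPower d (jordanMatrix c) ^ k) β α =
        (∏ i, c i ^ α.1 i) ^ k * (k ^ α.1 1 * (α.1 0 + α.1 1).choose (α.1 1)) :=
      fun k => vecMul_symPower_jordanMatrix_pow c hc k α
    simp only [h2] at h
    have hch : (((α.1 0 + α.1 1).choose (α.1 1) : ℕ) : R) ≠ 0 :=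
      Nat.cast_ne_zero.2 (Nat.choose_pos (by lia)).ne'
    refine (mul_eq_zero.1 (?_ : ((α.1 0 + α.1 1).choose (α.1 1) : R) * _ = 0)).resolve_left hch
    rw [iterate_X_mul_derivative_sum, Polynomial.eval_finsetSum, Finset.mul_sum, ← h]
    refine Finset.sum_congr rfl fun k _ => ?_
    simp only [Polynomial.eval_mul, Polynomial.eval_C, Polynomial.eval_pow, Polynomial.eval_X, μ]
    ring
  -- The fibre of `mergeExponent` through `γ` has a single eigenvalue, and its coordinates at
  -- position 1 take all values from 0 to `γ 0 + γ 1`.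
  have hroot : ∀ γ, γ.1 0 + γ.1 1 < p.rootMultiplicity (μ γ) := fun γ => by
    refine lt_rootMultiplicity_of_iterate (hμ γ) _ p hp fun j hj => ?_
    have hj' : j ≤ mergeExponent γ.1 0 := hj
    have hα := heval ⟨shiftExponent (mergeExponent γ.1) j,
      (degree_shiftExponent hj' (mergeExponent_one _)).trans
        ((degree_mergeExponent _).trans γ.2)⟩
    have hm := ((shiftExponent_eq_iff hj' (mergeExponent_one _)).1 rfl).1
    have hμ' : μ ⟨shiftExponent (mergeExponent γ.1) j,
      (degree_shiftExponent hj' (mergeExponent_one _)).trans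
        ((degree_mergeExponent _).trans γ.2)⟩ = μ γ := by
      simp only [μ]
      rw [← prod_pow_mergeExponent c hc, ← hm, prod_pow_mergeExponent c hc]
    rwa [hμ', shiftExponent_one] at hα
  -- An exponent with eigenvalue `μ γ` is determined by its coordinate at position 1, so there are
  -- at most `γ 0 + γ 1 + 1` of them. Hence `p` has at least `N` roots with multiplicity, too many
  -- for its degree.
  have hle : Finset.univ.val.map μ ≤ p.roots := by
    rw [Multiset.le_iff_count]
    intro x
    rw [Polynomial.count_roots, Multiset.count_map]
    by_cases hx : ∃ γ, μ γ = x
    · obtain ⟨γ, rfl⟩ := hx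
      refine le_trans ?_ (Nat.succ_le_of_lt (hroot γ))
      have : (Finset.univ.filter fun α => μ γ = μ α).card ≤
          (Finset.range (γ.1 0 + γ.1 1 + 1)).card := by
        refine Finset.card_le_card_of_injOn (fun α => α.1 1) (fun α hα => ?_)
          fun α hα β hβ hαβ => ?_
        · have h := DFunLike.congr_fun (hinj _ _ (Finset.mem_filter.1 hα).2) 0
          rw [mergeExponent_zero, mergeExponent_zero] at h
          simp only [Finset.coe_range, Set.mem_Iio]
          lia
        · have h : mergeExponent α.1 = mergeExponent β.1 := hinj _ _
            ((Finset.mem_filter.1 hα).2.symm.trans (Finset.mem_filter.1 hβ).2)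
          have h0 := DFunLike.congr_fun h 0
          rw [mergeExponent_zero, mergeExponent_zero] at h0
          have hαβ' : α.1 1 = β.1 1 := hαβ
          exact Subtype.ext (finsupp_fin_ext (by lia) hαβ'
            fun i => DFunLike.congr_fun h i.succ.succ)
      rwa [Finset.card_range] at this
    · rw [Multiset.card_eq_zero.2, ]
      · exact Nat.zero_le _
      · rw [Multiset.filter_eq_nil]
        exact fun α _ h => hx ⟨α, h.symm⟩
  have h1 := Multiset.card_le_card hle
  rw [Multiset.card_map, Finset.card_val, Finset.card_univ, ← Fintype.card_congr e,
    Fintype.card_fin] at h1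
  have h2 := p.card_roots'
  have h3 := (Polynomial.natDegree_lt_iff_degree_lt hp).2 hpdeg
  lia

theorem exists_not_discrGeneric_dvd {m d : ℕ}
    (e : Fin (numMonomials (m + 2) d) ≃ Exponents (m + 2) d) :
    ∃ f : MvPolynomial (Fin (m + 2)) ℂ, f.IsHomogeneous d ∧
      ¬ discrGeneric (m + 2) ∣ (kalmanMatrix e f).det := by
  -- With indeterminates as eigenvalues, each `c^α` is a monomial, so coincidences are only those
  -- forced by `c 1 = c 0`.
  let c : Fin (m + 2) → MvPolynomial (Fin (m + 2)) ℂ :=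
    Fin.cons (X 0) (Fin.cons (X 0) fun i => X i.succ.succ)
  have hprod : ∀ α : Fin (m + 2) →₀ ℕ, ∏ i, c i ^ α i = monomial (mergeExponent α) 1 :=
    fun α => by
      rw [← prod_pow_mergeExponent c rfl, monomial_eq,
        Finsupp.prod_fintype _ _ (fun _ => pow_zero _)]
      simp [Fin.prod_univ_succ (n := m + 1), Fin.prod_univ_succ (n := m), c, mergeExponent_one]
  let φ : EntryRing (m + 2) →ₐ[ℂ] MvPolynomial (Fin (m + 2)) ℂ :=
    aeval fun ij => jordanMatrix c ij.1 ij.2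
  have hφ : (genericMatrix (m + 2)).map φ = jordanMatrix c := by
    ext i j : 2
    simp [φ]
  let f : MvPolynomial (Fin (m + 2)) ℂ :=
    ∑ α : Exponents (m + 2) d, monomial α.1 (if α.1 1 = 0 then 1 else 0)
  refine ⟨f, IsHomogeneous.sum _ _ _ fun α _ => isHomogeneous_monomial _ α.2, fun hdvd => ?_⟩
  have h := map_dvd φ hdvd
  rw [map_discrGeneric (by lia), hφ, charpoly_jordanMatrix,
    discr_prod_X_sub_C_eq_zero c (i := 0) (j := 1) (by simp) rfl, zero_dvd_iff,
    map_det_kalmanMatrix, hφ] at h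
  refine det_krylovMatrix_jordanMatrix_ne_zero e c rfl (fun i => ?_) (fun α β h => ?_)
    (Eq.trans ?_ h)
  · refine Fin.cases ?_ (fun i => Fin.cases ?_ (fun i => ?_) i) i <;> exact X_ne_zero _
  · rw [hprod, hprod] at h
    exact monomial_left_injective one_ne_zero h
  · congr 2
    ext α : 1
    rw [coeff_sum, Finset.sum_eq_single α]
    · rw [coeff_monomial, if_pos rfl]
      split_ifs <;> simp
    · intro β _ hβ
      rw [coeff_monomial, if_neg fun h => hβ (Subtype.ext h)]
    · simp

/-! ### Matrices with a repeated eigenvalue -/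

/-- The matrix obtained from `T` by replacing its first two columns by those of an upper triangular
matrix with equal diagonal entries. -/
def repeatedEigenvalueShape {R : Type*} [CommRing R] {m : ℕ}
    (T : Matrix (Fin (m + 2)) (Fin (m + 2)) R) : Matrix (Fin (m + 2)) (Fin (m + 2)) R :=
  Matrix.of fun i => Fin.cons (if i = 0 then T 0 0 else 0)
    (Fin.cons (if i = 0 then T 0 1 else if i = 1 then T 0 0 else 0) fun j => T i j.succ.succ)

theorem repeatedEigenvalueShape_map {R S : Type*} [CommRing R] [CommRing S] {m : ℕ}
    (T : Matrix (Fin (m + 2)) (Fin (m + 2)) R) (φ : R →+* S) :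
    (repeatedEigenvalueShape T).map φ = repeatedEigenvalueShape (T.map φ) := by
  ext i j
  refine Fin.cases ?_ (fun j => Fin.cases ?_ (fun j => ?_) j) j
  · simp [repeatedEigenvalueShape, apply_ite φ]
  · simp [repeatedEigenvalueShape, apply_ite φ]
  · simp [repeatedEigenvalueShape]

theorem repeatedEigenvalueShape_smul {R : Type*} [CommRing R] {m : ℕ} (a : R)
    (T : Matrix (Fin (m + 2)) (Fin (m + 2)) R) :
    repeatedEigenvalueShape (a • T) = a • repeatedEigenvalueShape T := by
  ext i j
  refine Fin.cases ?_ (fun j => Fin.cases ?_ (fun j => ?_) j) j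
  · simp [repeatedEigenvalueShape]
  · simp [repeatedEigenvalueShape]
  · simp [repeatedEigenvalueShape]

theorem repeatedEigenvalueShape_eq_self {R : Type*} [CommRing R] {m : ℕ}
    {T : Matrix (Fin (m + 2)) (Fin (m + 2)) R} (h0 : ∀ i, i ≠ 0 → T i 0 = 0)
    (h1 : ∀ i, i ≠ 0 → i ≠ 1 → T i 1 = 0) (h : T 1 1 = T 0 0) : repeatedEigenvalueShape T = T := by
  ext i j
  refine Fin.cases ?_ (fun j => Fin.cases ?_ (fun j => ?_) j) j
  · by_cases hi : i = 0
    · simp [repeatedEigenvalueShape, hi]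
    · simp [repeatedEigenvalueShape, hi, h0]
  · by_cases hi : i = 0
    · simp [repeatedEigenvalueShape, hi]
    · by_cases hi' : i = 1
      · simp [repeatedEigenvalueShape, hi', h]
      · simp [repeatedEigenvalueShape, hi, hi', h1]
  · simp [repeatedEigenvalueShape]

theorem det_of_column_zero {R : Type*} [CommRing R] {k : ℕ}
    (M : Matrix (Fin (k + 1)) (Fin (k + 1)) R) (h : ∀ i : Fin k, M i.succ 0 = 0) :
    M.det = M 0 0 * (M.submatrix Fin.succ Fin.succ).det := by
  rw [Matrix.det_succ_column_zero, Fin.sum_univ_succ, Finset.sum_eq_zero]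
  · simp
  · intro i _
    rw [h]
    simp

theorem sq_dvd_charpoly_repeatedEigenvalueShape {R : Type*} [CommRing R] {m : ℕ}
    (T : Matrix (Fin (m + 2)) (Fin (m + 2)) R) :
    (Polynomial.X - Polynomial.C (T 0 0)) ^ 2 ∣ (repeatedEigenvalueShape T).charpoly := by
  rw [Matrix.charpoly, det_of_column_zero, det_of_column_zero, ← mul_assoc, sq]
  · refine Dvd.intro _ (congrArg₂ _ (congrArg₂ _ ?_ ?_) rfl)
    · rw [Matrix.charmatrix_apply_eq]
      simp [repeatedEigenvalueShape]
    · rw [Matrix.submatrix_apply, Matrix.charmatrix_apply_eq]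
      simp [repeatedEigenvalueShape]
  · intro i
    have hi : i.succ.succ ≠ 1 := fun h => Fin.succ_ne_zero i (Fin.succ_injective _ h)
    refine (Matrix.charmatrix_apply_ne _ _ _ hi).trans ?_
    simp [repeatedEigenvalueShape, hi]
  · intro i
    rw [Matrix.charmatrix_apply_ne _ _ _ (by simp)]
    simp [repeatedEigenvalueShape]

/-- The adjugate replaces the inverse to keep the parametrization polynomial; the extra factor `det
P` is absorbed into `T`, as the shape is linear in `T`. -/
theorem discr_charpoly_conj_repeatedEigenvalueShape {K : Type*} [Field K] {m : ℕ}
    {P : Matrix (Fin (m + 2)) (Fin (m + 2)) K} (hP : P.det ≠ 0)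
    (T : Matrix (Fin (m + 2)) (Fin (m + 2)) K) :
    (P * repeatedEigenvalueShape T * P.adjugate).charpoly.discr = 0 := by
  have h : P * repeatedEigenvalueShape T * P.adjugate =
      P * repeatedEigenvalueShape (P.det • T) * P⁻¹ := by
    rw [repeatedEigenvalueShape_smul, Matrix.inv_def, Ring.inverse_eq_inv', Matrix.mul_smul,
      Matrix.mul_smul, Matrix.smul_mul, smul_smul, inv_mul_cancel₀ hP, one_smul]
  rw [h, charpoly_conj_of_mul_eq_one (Matrix.mul_nonsing_inv P (Ne.isUnit hP))]
  by_contra hne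
  have hsep := (discr_ne_zero_iff_separable (Matrix.charpoly_monic _)
    (by rw [Matrix.charpoly_natDegree_eq_dim]; simp)).1 hne
  have hdvd := sq_dvd_charpoly_repeatedEigenvalueShape (P.det • T)
  rw [sq] at hdvd
  exact Polynomial.not_isUnit_X_sub_C _ (hsep.squarefree _ hdvd)

/-- Put `g = f - μ`. If `ker g = ker g²`, the generalized eigenspace is the eigenspace and two
independent eigenvectors serve with `s = 0`. Otherwise take `w` in `ker g²` outside `ker g` and `v =
g w`, with `s = 1`. -/
theorem exists_pair_of_two_le_finrank {K V : Type*} [Field K] [AddCommGroup V] [Module K V]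
    [FiniteDimensional K V] (f : Module.End K V) (μ : K)
    (h : 2 ≤ Module.finrank K (f.maxGenEigenspace μ)) :
    ∃ (v w : V) (s : K), LinearIndependent K ![v, w] ∧ f v = μ • v ∧ f w = s • v + μ • w := by
  set g := f - μ • (1 : Module.End K V) with hg
  have hf : ∀ x, f x = g x + μ • x := fun x => by simp [hg]
  by_cases hker : LinearMap.ker g = LinearMap.ker (g ^ 2)
  · have hmax : f.maxGenEigenspace μ ≤ LinearMap.ker g := by
      intro x hx
      obtain ⟨k, hk⟩ := (Module.End.mem_maxGenEigenspace _ _ _).1 hx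
      have h2 : LinearMap.ker (g ^ 1) = LinearMap.ker (g ^ (1 + k)) :=
        Module.End.ker_pow_constant (by simpa using hker) k
      rw [pow_one] at h2
      rw [h2, LinearMap.mem_ker, pow_add, Module.End.mul_apply]
      exact (congrArg _ hk).trans (map_zero _)
    have h1 : 1 < Module.finrank K (LinearMap.ker g) :=
      lt_of_lt_of_le h (Submodule.finrank_mono hmax)
    obtain ⟨v, hv⟩ := Module.finrank_pos_iff_exists_ne_zero.1 (zero_lt_one.trans h1)
    obtain ⟨w, hvw⟩ := exists_linearIndependent_pair_of_one_lt_finrank h1 hv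
    refine ⟨v, w, 0, ?_, ?_, ?_⟩
    · have := hvw.map' (LinearMap.ker g).subtype (Submodule.ker_subtype _)
      convert! this using 1
      ext i
      fin_cases i <;> rfl
    · rw [hf, LinearMap.mem_ker.1 v.2, zero_add]
    · rw [hf, LinearMap.mem_ker.1 w.2, zero_smul]
  · have hle : LinearMap.ker g ≤ LinearMap.ker (g ^ 2) := fun x hx => by
      rw [LinearMap.mem_ker, sq, Module.End.mul_apply, LinearMap.mem_ker.1 hx, map_zero]
    obtain ⟨w, hw2, hw⟩ := SetLike.exists_of_lt (lt_of_le_of_ne hle hker)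
    rw [LinearMap.mem_ker] at hw
    rw [LinearMap.mem_ker, sq, Module.End.mul_apply] at hw2
    refine ⟨g w, w, 1, LinearIndependent.pair_iff.2 fun a b hab => ?_, ?_, ?_⟩
    · have h2 := congrArg g hab
      rw [map_add, map_smul, map_smul, hw2, smul_zero, zero_add, map_zero] at h2
      have hb := (smul_eq_zero.1 h2).resolve_right hw
      rw [hb, zero_smul, add_zero] at hab
      exact ⟨(smul_eq_zero.1 hab).resolve_right hw, hb⟩
    · rw [hf, hw2, zero_add]
    · rw [hf, one_smul]

theorem exists_basis_extending_pair {K : Type*} [Field K] {m : ℕ} {v w : Fin (m + 2) → K}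
    (h : LinearIndependent K ![v, w]) :
    ∃ b : Module.Basis (Fin (m + 2)) K (Fin (m + 2) → K), b 0 = v ∧ b 1 = w := by
  let b := Module.Basis.sumExtend h
  have : Fintype (Module.Basis.sumExtendIndex h) :=
    have := FiniteDimensional.fintypeBasisIndex b
    Fintype.ofInjective (Sum.inr : _ → Fin 2 ⊕ Module.Basis.sumExtendIndex h) Sum.inr_injective
  have hcard : Fintype.card (Module.Basis.sumExtendIndex h) = m := by
    have := Module.finrank_eq_card_basis b
    simp only [Module.finrank_fin_fun, Fintype.card_sum, Fintype.card_fin] at this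
    lia
  let e : Fin 2 ⊕ Module.Basis.sumExtendIndex h ≃ Fin (m + 2) :=
    ((Equiv.refl _).sumCongr (Fintype.equivFinOfCardEq hcard)).trans
      (finSumFinEquiv.trans (finCongr (add_comm 2 m)))
  have hinl : ∀ i, b (Sum.inl i) = ![v, w] i := fun i => by
    simp only [b, Module.Basis.sumExtend, Module.Basis.reindex_apply, Module.Basis.extend_apply_self]
    rfl
  have he : ∀ i, b.reindex e (e (Sum.inl i)) = ![v, w] i := fun i => by
    rw [Module.Basis.reindex_apply, Equiv.symm_apply_apply, hinl]
  exact ⟨b.reindex e, he 0, he 1⟩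

/-- A double root of the characteristic polynomial has a generalized eigenspace of dimension at
least 2; a basis beginning with the resulting pair gives the shape. -/
theorem exists_eq_conj_repeatedEigenvalueShape {K : Type*} [Field K] [IsAlgClosed K] {m : ℕ}
    (A : Matrix (Fin (m + 2)) (Fin (m + 2)) K) (hA : A.charpoly.discr = 0) :
    ∃ P T, A = P * repeatedEigenvalueShape T * P.adjugate := by
  classical
  have hsep := mt (discr_ne_zero_iff_separable A.charpoly_monic
    (by rw [Matrix.charpoly_natDegree_eq_dim]; simp)).2 (not_not.2 hA)
  rw [← Polynomial.nodup_roots_iff_of_splits A.charpoly_monic.ne_zero (IsAlgClosed.splits _),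
    Multiset.nodup_iff_count_le_one] at hsep
  push Not at hsep
  obtain ⟨μ, hμ⟩ := hsep
  rw [Polynomial.count_roots, ← Matrix.charpoly_toLin',
    ← LinearMap.finrank_maxGenEigenspace_eq] at hμ
  obtain ⟨v, w, s, hvw, hv, hw⟩ := exists_pair_of_two_le_finrank _ μ hμ
  obtain ⟨b, rfl, rfl⟩ := exists_basis_extending_pair hvw
  let P := (Pi.basisFun K (Fin (m + 2))).toMatrix b
  let T := LinearMap.toMatrix b b (Matrix.toLin' A)
  have hT : repeatedEigenvalueShape T = T := by
    have h0 : ∀ i, T i 0 = if i = 0 then μ else 0 := fun i => by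
      refine (LinearMap.toMatrix_apply b b _ i 0).trans ?_
      rw [hv, map_smul, b.repr_self]
      simp [Finsupp.single_apply, eq_comm]
    have h1 : ∀ i, T i 1 = (if i = 0 then s else 0) + if i = 1 then μ else 0 := fun i => by
      refine (LinearMap.toMatrix_apply b b _ i 1).trans ?_
      rw [hw, map_add, map_smul, map_smul, b.repr_self, b.repr_self]
      simp [Finsupp.single_apply, eq_comm]
    refine repeatedEigenvalueShape_eq_self (fun i hi => ?_) (fun i hi hi' => ?_) ?_
    · rw [h0, if_neg hi]
    · rw [h1, if_neg hi, if_neg hi', add_zero]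
    · rw [h0, h1]; simp
  have hPQ : P * b.toMatrix (Pi.basisFun K (Fin (m + 2))) = 1 :=
    Module.Basis.toMatrix_mul_toMatrix_flip _ _
  have hdet : IsUnit P.det := Matrix.isUnit_det_of_right_inverse hPQ
  have hPT : P * T * P⁻¹ = A := by
    rw [Matrix.inv_eq_right_inv hPQ, basis_toMatrix_mul_linearMap_toMatrix_mul_basis_toMatrix]
    exact LinearMap.toMatrix'_toLin' A
  refine ⟨P, P.det⁻¹ • T, ?_⟩
  rw [repeatedEigenvalueShape_smul, hT]
  conv_lhs => rw [← hPT, Matrix.inv_def, Ring.inverse_eq_inv']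
  rw [Matrix.mul_smul, Matrix.mul_smul, Matrix.smul_mul]

/-! ### Polynomial parametrization of the discriminant hypersurface -/

/-- The ring of polynomials in the entries of two matrices. -/
abbrev PairEntryRing (n : ℕ) : Type := MvPolynomial ((Fin n × Fin n) ⊕ (Fin n × Fin n)) ℂ

/-- The parametrization of the matrices with a repeated eigenvalue. -/
def repeatedEigenvalueHom (m : ℕ) : EntryRing (m + 2) →ₐ[ℂ] PairEntryRing (m + 2) :=
  aeval fun ij =>
    ((Matrix.of fun i j => X (Sum.inl (i, j))) *
      repeatedEigenvalueShape (Matrix.of fun i j => X (Sum.inr (i, j))) *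
      (Matrix.of fun i j => X (Sum.inl (i, j))).adjugate : Matrix _ _ (PairEntryRing (m + 2)))
      ij.1 ij.2

theorem map_genericMatrix_aeval {R : Type*} [CommRing R] [Algebra ℂ R] {n : ℕ}
    (A : Matrix (Fin n) (Fin n) R) :
    (genericMatrix n).map (aeval (R := ℂ) fun ij : Fin n × Fin n => A ij.1 ij.2) = A := by
  ext i j
  simp

theorem algHom_eq_aeval {R : Type*} [CommRing R] [Algebra ℂ R] {n : ℕ}
    (φ : EntryRing n →ₐ[ℂ] R) {A : Matrix (Fin n) (Fin n) R} (h : (genericMatrix n).map φ = A) :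
    φ = aeval fun ij => A ij.1 ij.2 := by
  ext ij
  rw [aeval_X, ← h]
  rfl

theorem map_genericMatrix_comp_repeatedEigenvalueHom {R : Type*} [CommRing R] [Algebra ℂ R] {m : ℕ}
    (ψ : PairEntryRing (m + 2) →ₐ[ℂ] R) :
    (genericMatrix (m + 2)).map (ψ.comp (repeatedEigenvalueHom m)) =
      (Matrix.of fun i j => ψ (X (Sum.inl (i, j)))) *
      repeatedEigenvalueShape (Matrix.of fun i j => ψ (X (Sum.inr (i, j)))) *
      (Matrix.of fun i j => ψ (X (Sum.inl (i, j)))).adjugate := by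
  have h := map_genericMatrix_aeval
    ((Matrix.of fun i j => X (Sum.inl (i, j))) *
      repeatedEigenvalueShape (Matrix.of fun i j => X (Sum.inr (i, j))) *
      (Matrix.of fun i j => X (Sum.inl (i, j))).adjugate :
      Matrix (Fin (m + 2)) (Fin (m + 2)) (PairEntryRing (m + 2)))
  have h2 := congrArg (fun M => M.map (ψ : PairEntryRing (m + 2) →+* R)) h
  simp only [Matrix.map_mul, repeatedEigenvalueShape_map] at h2
  refine Eq.trans ?_ (h2.trans ?_)
  · rfl
  · rw [← RingHom.mapMatrix_apply _ (Matrix.adjugate _), RingHom.map_adjugate]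
    rfl

theorem map_eq_zero_of_repeatedEigenvalueHom_eq_zero {R : Type*} [CommRing R] [Algebra ℂ R] {m : ℕ}
    {φ : EntryRing (m + 2) →ₐ[ℂ] R} {P T : Matrix (Fin (m + 2)) (Fin (m + 2)) R}
    (h : (genericMatrix (m + 2)).map φ = P * repeatedEigenvalueShape T * P.adjugate)
    {p : EntryRing (m + 2)} (hp : repeatedEigenvalueHom m p = 0) : φ p = 0 := by
  let ψ : PairEntryRing (m + 2) →ₐ[ℂ] R :=
    aeval (Sum.elim (fun ij => P ij.1 ij.2) fun ij => T ij.1 ij.2)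
  have hψ := map_genericMatrix_comp_repeatedEigenvalueHom ψ
  simp only [ψ, aeval_X, Sum.elim_inl, Sum.elim_inr] at hψ
  have key : φ = ψ.comp (repeatedEigenvalueHom m) :=
    (algHom_eq_aeval φ h).trans (algHom_eq_aeval _ hψ).symm
  rw [key, AlgHom.comp_apply, hp, map_zero]

theorem repeatedEigenvalueHom_discrGeneric (m : ℕ) :
    repeatedEigenvalueHom m (discrGeneric (m + 2)) = 0 := by
  let F := FractionRing (PairEntryRing (m + 2))
  let ψ : PairEntryRing (m + 2) →ₐ[ℂ] F := IsScalarTower.toAlgHom ℂ _ _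
  have hψ : Function.Injective ψ := IsFractionRing.injective _ F
  rw [← map_eq_zero_iff ψ hψ, ← AlgHom.comp_apply, map_discrGeneric (by lia),
    map_genericMatrix_comp_repeatedEigenvalueHom]
  refine discr_charpoly_conj_repeatedEigenvalueShape ?_ _
  let B : Matrix (Fin (m + 2)) (Fin (m + 2)) (PairEntryRing (m + 2)) :=
    Matrix.of fun i j => X (Sum.inl (i, j))
  have hB : (Matrix.of fun i j => ψ (X (Sum.inl (i, j)))) =
    ψ.mapMatrix B := rfl
  rw [hB, ← AlgHom.map_det, Ne, map_eq_zero_iff ψ hψ]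
  intro h0
  -- The generic determinant is nonzero because it takes the value 1 at the identity.
  have h1 := congrArg (aeval (R := ℂ) (Sum.elim (fun ij : Fin (m + 2) × Fin (m + 2) =>
    (1 : Matrix (Fin (m + 2)) (Fin (m + 2)) ℂ) ij.1 ij.2) 0)) h0
  rw [AlgHom.map_det, map_zero] at h1
  refine one_ne_zero (Eq.trans ?_ h1)
  rw [← Matrix.det_one (n := Fin (m + 2))]
  congr 1
  ext i j
  simp [B]

/-- The generic point of `q = 0` is a matrix with a repeated eigenvalue, hence is reached by the
parametrization; whatever vanishes on the parametrization vanishes there. -/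
theorem dvd_of_repeatedEigenvalueHom_eq_zero {m : ℕ} {p q : EntryRing (m + 2)} (hq : Irreducible q)
    (hqd : q ∣ discrGeneric (m + 2)) (hp : repeatedEigenvalueHom m p = 0) : q ∣ p := by
  obtain ⟨K, _, _, _, φ, hφ⟩ := exists_algHom_ker_eq_span hq
  rw [← hφ] at hqd ⊢
  rw [map_discrGeneric (by lia)] at hqd
  obtain ⟨P, T, h⟩ := exists_eq_conj_repeatedEigenvalueShape _ hqd
  exact map_eq_zero_of_repeatedEigenvalueHom_eq_zero h hp

/-! ### Order of vanishing of the discriminant along a curve -/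

/-- A curve of matrices meeting the discriminant transversally at `t = 0`. -/
def transversalCurve {R : Type*} [CommRing R] {m : ℕ} (a : Fin (m + 2) → R) (t : R) :
    Matrix (Fin (m + 2)) (Fin (m + 2)) R :=
  Matrix.diagonal a + Matrix.single 0 1 1 + Matrix.single 1 0 t

/-- The eigenvalues of `transversalCurve a (s ^ 2)`. -/
def curveEigenvalue {R : Type*} [CommRing R] {m : ℕ} (a : Fin (m + 2) → R) (s : R)
    (i : Fin (m + 2)) : R :=
  a i + if i = 0 then s else if i = 1 then -s else 0

/-- The leading block has eigenvalues `a 0 ± s`. Since `e₀ + s e₁` is an eigenvector for `a 0 + s`,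
conjugation by a unipotent matrix triangularizes. -/
theorem charpoly_transversalCurve {R : Type*} [CommRing R] {m : ℕ} (a : Fin (m + 2) → R) (s : R)
    (ha : a 0 = a 1) : (transversalCurve a (s ^ 2)).charpoly =
      ∏ i, (Polynomial.X - Polynomial.C (curveEigenvalue a s i)) := by
  let U : Matrix (Fin (m + 2)) (Fin (m + 2)) R :=
    Matrix.diagonal (curveEigenvalue a s) + Matrix.single 0 1 1
  let P : Matrix (Fin (m + 2)) (Fin (m + 2)) R := 1 + Matrix.single 1 0 s
  let Q : Matrix (Fin (m + 2)) (Fin (m + 2)) R := 1 - Matrix.single 1 0 s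
  have hPQ : P * Q = 1 := by
    simp only [P, Q, add_mul, mul_sub, one_mul, mul_one]
    rw [Matrix.single_mul_single_of_ne _ _ _ _ (by simp)]
    abel
  have hU : transversalCurve a (s ^ 2) = P * U * Q := by
    have : transversalCurve a (s ^ 2) * P = P * U := by
      simp only [transversalCurve, P, U, add_mul, mul_add, one_mul, mul_one]
      rw [Matrix.single_mul_single_same, Matrix.single_mul_single_same,
        Matrix.single_mul_single_of_ne _ _ _ _ (by simp)]
      ext i j
      by_cases hi : i = 0
      · subst hi
        by_cases hj : j = 0
        · subst hj
          simp [curveEigenvalue, add_comm]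
        · by_cases hj' : j = 1
          · subst hj'; simp
          · simp [hj, Ne.symm hj, Ne.symm hj']
      · by_cases hi' : i = 1
        · subst hi'
          by_cases hj : j = 0
          · subst hj; simp [curveEigenvalue, ha]; ring
          · by_cases hj' : j = 1
            · subst hj'; simp [curveEigenvalue]
            · simp [Ne.symm hj, Ne.symm hj']
        · by_cases hj : i = j
          · subst hj; simp [curveEigenvalue, hi, hi', Ne.symm hi, Ne.symm hi']
          · simp [hj, Ne.symm hi, Ne.symm hi']
    rw [← this, mul_assoc, hPQ, mul_one]
  rw [hU, charpoly_conj_of_mul_eq_one hPQ, Matrix.charpoly_of_isUpperTriangular]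
  · refine Finset.prod_congr rfl fun i _ => ?_
    have : ¬ ((0 : Fin (m + 2)) = i ∧ 1 = i) := by
      rintro ⟨rfl, h⟩; simp at h
    simp [U, this]
  · intro i j hij
    have hij' : j < i := hij
    have : ¬ ((0 : Fin (m + 2)) = i ∧ 1 = j) := by
      rintro ⟨rfl, rfl⟩; simp at hij'
    simp [U, this, hij'.ne']

theorem transversalCurve_map {R S : Type*} [CommRing R] [CommRing S] {m : ℕ}
    (a : Fin (m + 2) → R) (t : R) (φ : R →+* S) :
    (transversalCurve a t).map φ = transversalCurve (φ ∘ a) (φ t) := by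
  ext i j
  simp [transversalCurve, Matrix.single_apply, Matrix.diagonal_apply, apply_ite φ]

/-- The diagonal of the matrices of the curve along which the discriminant is computed. -/
def curveDiagonal (m : ℕ) (i : Fin (m + 2)) : ℂ := ((i.val - 1 : ℕ) : ℂ)

/-- Truncated subtraction makes the diagonal `0, 0, 1, 2, …`, so only the first two entries
coincide. -/
theorem curveDiagonal_injective {m : ℕ} {i j : Fin (m + 2)} (hij : i ≠ j) (hj : j ≠ 0)
    (hj' : j ≠ 1) : curveDiagonal m i ≠ curveDiagonal m j := by
  intro h
  have := Nat.cast_injective h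
  rw [Ne, Fin.ext_iff] at hij hj hj'
  simp only [Fin.val_zero, Fin.val_one] at hj hj'
  lia

/-- Evaluation at the point with parameter `t` of the curve. -/
def curveHom (m : ℕ) (t : Polynomial ℂ) : EntryRing (m + 2) →ₐ[ℂ] Polynomial ℂ :=
  aeval fun ij => transversalCurve (Polynomial.C ∘ curveDiagonal m) t ij.1 ij.2

theorem map_curveHom (m : ℕ) (t : Polynomial ℂ) :
    (genericMatrix (m + 2)).map (curveHom m t) =
      transversalCurve (Polynomial.C ∘ curveDiagonal m) t :=
  map_genericMatrix_aeval _

theorem map_comp_curveHom {R : Type*} [CommRing R] [Algebra ℂ R] (m : ℕ) (t : Polynomial ℂ)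
    (ψ : Polynomial ℂ →ₐ[ℂ] R) :
    (genericMatrix (m + 2)).map (ψ.comp (curveHom m t)) =
      transversalCurve (algebraMap ℂ R ∘ curveDiagonal m) (ψ t) := by
  have h := congrArg (fun M => M.map (ψ : Polynomial ℂ →+* R)) (map_curveHom m t)
  simp only [transversalCurve_map] at h
  refine Eq.trans ?_ (h.trans ?_)
  · rfl
  · congr 1
    ext i
    exact ψ.commutes _

/-- At `t = 0` the curve lies on the parametrized locus, so `t` divides the pullback of `p`; then
put `t = X²`. -/
theorem X_sq_dvd_curveHom {m : ℕ} {p : EntryRing (m + 2)} (hp : repeatedEigenvalueHom m p = 0) :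
    (Polynomial.X : Polynomial ℂ) ^ 2 ∣ curveHom m (Polynomial.X ^ 2) p := by
  have hX : Polynomial.X ∣ curveHom m Polynomial.X p := by
    rw [Polynomial.X_dvd_iff, Polynomial.coeff_zero_eq_eval_zero, ← Polynomial.coe_aeval_eq_eval]
    refine map_eq_zero_of_repeatedEigenvalueHom_eq_zero
      (φ := (Polynomial.aeval (0 : ℂ)).comp (curveHom m Polynomial.X)) (P := 1)
      (T := transversalCurve (curveDiagonal m) 0) ?_ hp
    rw [map_comp_curveHom, Matrix.adjugate_one, one_mul, mul_one, repeatedEigenvalueShape_eq_self]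
    · simp
    · intro i hi
      simp [transversalCurve, hi]
    · intro i hi hi'
      simp [transversalCurve, hi', Ne.symm hi]
    · simp [transversalCurve, curveDiagonal]
  have hcomp : (Polynomial.aeval (Polynomial.X ^ 2 : Polynomial ℂ)).comp
      (curveHom m Polynomial.X) = curveHom m (Polynomial.X ^ 2) := by
    have h1 := map_comp_curveHom m Polynomial.X
      (Polynomial.aeval (Polynomial.X ^ 2 : Polynomial ℂ))
    rw [Polynomial.aeval_X] at h1
    exact algHom_eq_aeval _ h1
  have h := map_dvd (Polynomial.aeval (Polynomial.X ^ 2 : Polynomial ℂ)) hX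
  rwa [Polynomial.aeval_X, ← AlgHom.comp_apply, hcomp] at h

/-- Only the differences `r 0 - r 1 = 2X` and `r 1 - r 0 = -2X` vanish at `X = 0`, so the order
there is exactly 2. -/
theorem curveHom_discrGeneric (m : ℕ) :
    ∃ w : Polynomial ℂ, ¬ Polynomial.X ∣ w ∧
      curveHom m (Polynomial.X ^ 2) (discrGeneric (m + 2)) = Polynomial.X ^ 2 * w := by
  set r : Fin (m + 2) → Polynomial ℂ :=
    curveEigenvalue (Polynomial.C ∘ curveDiagonal m) Polynomial.X with hr
  obtain ⟨k, hk⟩ := discr_prod_X_sub_C r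
  have hX : ∀ i j, i ≠ j → j ≠ 0 → j ≠ 1 → ¬ Polynomial.X ∣ r i - r j := fun i j hij hj hj' => by
    rw [Polynomial.X_dvd_iff, Polynomial.coeff_zero_eq_eval_zero]
    intro h0
    simp only [hr, curveEigenvalue, Function.comp, if_neg hj, if_neg hj', Polynomial.eval_sub,
      Polynomial.eval_add, Polynomial.eval_C, Polynomial.eval_zero,
      apply_ite (Polynomial.eval (0 : ℂ)), Polynomial.eval_neg, Polynomial.eval_X, neg_zero,
      ite_self, add_zero] at h0
    exact curveDiagonal_injective hij hj hj' (sub_eq_zero.1 h0)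
  have hX' : ∀ i j, i ≠ j → j ≠ 0 → j ≠ 1 → ¬ Polynomial.X ∣ r j - r i := fun i j hij hj hj' => by
    rw [dvd_sub_comm]
    exact hX i j hij hj hj'
  have hunit : ∀ {x : Polynomial ℂ}, IsUnit x → ¬ Polynomial.X ∣ x := fun hx h =>
    Polynomial.prime_X.not_isUnit (isUnit_of_dvd_unit h hx)
  have h2 : IsUnit (2 : Polynomial ℂ) :=
    (Polynomial.isUnit_C.2 (Ne.isUnit (two_ne_zero : (2 : ℂ) ≠ 0)))
  have h01 : r 0 - r 1 = Polynomial.X * 2 := by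
    simp [hr, curveEigenvalue, curveDiagonal]
    ring
  have hg0 : ∏ j ∈ Finset.univ.erase 0, (r 0 - r j) =
      Polynomial.X * 2 * ∏ j ∈ (Finset.univ.erase 0).erase 1, (r 0 - r j) := by
    rw [← h01, Finset.mul_prod_erase _ (fun j => r 0 - r j) (by simp)]
  have hg1 : ∏ j ∈ Finset.univ.erase 1, (r 1 - r j) =
      Polynomial.X * -2 * ∏ j ∈ (Finset.univ.erase 1).erase 0, (r 1 - r j) := by
    rw [mul_neg, ← h01, neg_sub, Finset.mul_prod_erase _ (fun j => r 1 - r j) (by simp)]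
  refine ⟨(-1) ^ k * (2 * ∏ j ∈ (Finset.univ.erase 0).erase 1, (r 0 - r j)) *
    (-2 * ∏ j ∈ (Finset.univ.erase 1).erase 0, (r 1 - r j)) *
    ∏ i : Fin m, ∏ j ∈ Finset.univ.erase i.succ.succ, (r i.succ.succ - r j), ?_, ?_⟩
  · simp only [Polynomial.prime_X.dvd_mul, Polynomial.prime_X.dvd_finsetProd_iff, not_or,
      not_exists, not_and]
    refine ⟨⟨⟨hunit (isUnit_one.neg.pow k), hunit h2, fun j hj => ?_⟩, hunit h2.neg,
      fun j hj => ?_⟩, fun i _ j hj => ?_⟩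
    · simp only [Finset.mem_erase] at hj
      exact hX _ _ hj.2.1.symm hj.2.1 hj.1
    · simp only [Finset.mem_erase] at hj
      exact hX _ _ hj.2.1.symm hj.1 hj.2.1
    · exact hX' _ _ (Finset.ne_of_mem_erase hj) (Fin.succ_ne_zero _)
        fun h => Fin.succ_ne_zero i (Fin.succ_injective _ h)
  · rw [map_discrGeneric (by lia), map_curveHom, charpoly_transversalCurve _ _ rfl, hk,
      Fin.prod_univ_succ, Fin.prod_univ_succ, Fin.succ_zero_eq_one, hg0, hg1]
    ring

/-! ### Irreducibility of the discriminant and conclusion -/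

/-- The discriminant of the characteristic polynomial is irreducible: it is associated to each of
its irreducible factors. -/
theorem associated_discrGeneric_of_dvd {m : ℕ} {q : EntryRing (m + 2)} (hq : Irreducible q)
    (hqd : q ∣ discrGeneric (m + 2)) : Associated q (discrGeneric (m + 2)) := by
  obtain ⟨w, hw, hdisc⟩ := curveHom_discrGeneric m
  have hne : discrGeneric (m + 2) ≠ 0 := fun h0 => by
    rw [h0, map_zero] at hdisc
    rcases mul_eq_zero.1 hdisc.symm with h | h
    · exact pow_ne_zero 2 Polynomial.X_ne_zero h
    · exact hw (h ▸ dvd_zero _)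
  -- The kernel is a prime ideal, nonzero since it contains `Δ`, so by factoriality it contains a
  -- prime element; every irreducible factor of `Δ` divides it.
  obtain ⟨p, hp, hprime⟩ := (RingHom.ker_isPrime
    (repeatedEigenvalueHom m : EntryRing (m + 2) →+* _)).exists_mem_prime_of_ne_bot fun h => hne (by
      rw [← Ideal.mem_bot, ← h]
      exact repeatedEigenvalueHom_discrGeneric m)
  have hp' : repeatedEigenvalueHom m p = 0 := hp
  have hassoc : ∀ {q' : EntryRing (m + 2)}, Irreducible q' → q' ∣ discrGeneric (m + 2) →
      Associated q' p := fun hq' h =>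
    hq'.associated_of_dvd hprime.irreducible (dvd_of_repeatedEigenvalueHom_eq_zero hq' h hp')
  obtain ⟨s, hs⟩ := hqd
  by_cases hunit : IsUnit s
  · rw [hs]
    exact (associated_mul_unit_right q s hunit)
  · have hs0 : s ≠ 0 := fun h => hne (by rw [hs, h, mul_zero])
    obtain ⟨q', hq', hq's⟩ := WfDvdMonoid.exists_irreducible_factor hunit hs0
    -- A second irreducible factor would also be associated to `p`, so `p²` would divide `Δ`. On the
    -- curve this gives `X⁴ ∣ X² w`, contradicting `¬ X ∣ w`.
    have hpp : p * p ∣ discrGeneric (m + 2) := by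
      have h1 := (hassoc hq ⟨s, hs⟩).dvd'
      have h2 := (hassoc hq' (hq's.trans ⟨q, by rw [hs, mul_comm]⟩)).dvd'.trans hq's
      rw [hs]
      exact mul_dvd_mul h1 h2
    have h := map_dvd (curveHom m (Polynomial.X ^ 2)) hpp
    have hX := X_sq_dvd_curveHom hp'
    rw [hdisc, map_mul] at h
    have h3 := (mul_dvd_mul hX hX).trans h
    rw [mul_dvd_mul_iff_left (pow_ne_zero 2 Polynomial.X_ne_zero)] at h3
    exact absurd ((dvd_pow_self _ two_ne_zero).trans h3) hw

theorem discrGeneric_one : discrGeneric 1 = 1 := by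
  refine Polynomial.discr_of_degree_eq_one ?_
  rw [Matrix.charpoly_degree_eq_dim]
  simp

end

theorem mainTheorem7 (n d : ℕ) (hn : 0 < n) (hd : 0 < d)
    (e : Fin (numMonomials n d) ≃ Exponents n d) :
    (∀ f : MvPolynomial (Fin n) ℂ, f.IsHomogeneous d →
      ∀ q : EntryRing n, Irreducible q → q ∣ discrSymPower n d →
        q ∣ (kalmanMatrix e f).det ∨ q ∣ discrGeneric n) ∧
    (∀ q : EntryRing n, Irreducible q →
      ((∀ f : MvPolynomial (Fin n) ℂ, f.IsHomogeneous d → q ∣ (kalmanMatrix e f).det) ↔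
        q ∣ discrSymPower n d ∧ ¬ Associated q (discrGeneric n))) := by
  refine ⟨fun f _ q hq hqd => ?_, fun q hq => ⟨fun h => ⟨dvd_discrSymPower hn e hq h, ?_⟩, ?_⟩⟩
  · by_cases h : q ∣ discrGeneric n
    · exact Or.inr h
    · exact Or.inl (dvd_det_kalmanMatrix hn e f hq hqd h)
  · intro hassoc
    -- For `n = 1` the discriminant is 1, so no irreducible is associated to it.
    match n, hn with
    | 1, _ =>
      rw [discrGeneric_one] at hassoc
      exact hq.not_isUnit (hassoc.symm.isUnit isUnit_one)
    | m + 2, _ =>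
      obtain ⟨f, hf, hndvd⟩ := exists_not_discrGeneric_dvd e
      exact hndvd (hassoc.dvd'.trans (h f hf))
  · rintro ⟨hqd, hassoc⟩ f _
    refine dvd_det_kalmanMatrix hn e f hq hqd fun hdvd => hassoc ?_
    match n, hn with
    | 1, _ =>
      rw [discrGeneric_one] at hdvd
      exact absurd (isUnit_of_dvd_one hdvd) hq.not_isUnit
    | m + 2, _ => exact associated_discrGeneric_of_dvd hq hdvd
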